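/- For a finite graph $G$ with at least one vertex, let $d(G)=2e(G)/|G|$ denote its average degree. For integers $m\ge 0$ and $r\ge 2$, let $H(m,r)$ be the Hamming graph, i.e. the Cartesian product of $m$ copies of the complete graph $K_r$. There is a function $f:\mathbb{R}\to\mathbb{R}$ with $f(d)=o(d)$ as $d\to\infty$, depending on neither $m$ nor $r$, such that the following holds. (1) For all $m\ge 0$ and $r\ge 2$, every (not necessarily induced) subgraph of $H(m,r)$ with average degree $d\ge 2$ contains a cycle of length at least $$r^{\frac{d}{r-1}-f(d)}.$$ (2) In particular (case $r=3$), for every $m\ge 0$, every subgraph of the discrete torus $C_3^m$ (the Cartesian product of $m$ triangles) with average degree $d\ge 2$ contains a cycle of length at least $3^{d/2-f(d)}$, and every subgraph of $C_3^m$ with at least one vertex and average degree $d$ contains a path of length at least $3^{d/2-f(d)}-1$. -/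

import Mathlib

open Filter Asymptotics

namespace CruxCycles

/-- The `m`-fold Cartesian power of a graph `G`: two tuples are adjacent iff they are adjacent
in one coordinate and agree in all the others. -/
def cartesianPower {V : Type*} (G : SimpleGraph V) (m : ℕ) : SimpleGraph (Fin m → V) where
  Adj x y := ∃ i, G.Adj (x i) (y i) ∧ ∀ j, j ≠ i → x j = y j
  symm := ⟨fun _ _ ⟨i, hi, h⟩ => ⟨i, hi.symm, fun j hj => (h j hj).symm⟩⟩
  loopless := ⟨fun _ ⟨_, hi, _⟩ => G.irrefl hi⟩

/-- The Hamming graph `H(m, r)`: the Cartesian product of `m` copies of the complete graph on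
`r` vertices. -/
abbrev hammingGraph (m r : ℕ) : SimpleGraph (Fin m → Fin r) :=
  cartesianPower (⊤ : SimpleGraph (Fin r)) m

/-- The discrete torus: the Cartesian product of `m` copies of the triangle `C₃`. -/
abbrev discreteTorus (m : ℕ) : SimpleGraph (Fin m → Fin 3) :=
  cartesianPower (SimpleGraph.cycleGraph 3) m

/-- The average degree `2 e(H) / |H|` of a subgraph (of a finite graph). -/
noncomputable def averageDegree {V : Type*} {G : SimpleGraph V} (H : G.Subgraph) : ℝ :=
  2 * (H.edgeSet.ncard : ℝ) / (H.verts.ncard : ℝ)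

end CruxCycles

/-! Suppose a subgraph of `H(m,r)` has no cycle of length at least `L`. Growing a path depth-first
shows that, for every `M`, each set of at least `M` vertices contains some `A` with `M ≤ |A| ≤ 2M`
and at most `L` neighbours in the rest of the set (`exists_separated`). Peeling off such sets one
after another charges every edge to a set of at most `2M + L` vertices, so a bound on the average
degree of all such small sets passes to the whole graph at the cost of a factor `1 + L/M`
(`card_interedges_le_of_no_long_cycle`).

Small sets are sparse by edge-isoperimetry: `t` vertices of `H(m,r)` span average degree at most
`(r-1) log_r t`, by induction on `m` and subadditivity of entropy
(`card_interedges_hammingGraph_mul_log_le`).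

With `M = kL` the two combine to `d ≤ (1 + 1/k)(r-1) log_r((2k+1)L)`. Taking `k` near `√d` gives
`log_r L ≥ d/(r-1) - O(√d)`, uniformly in `m` and `r`. -/

namespace CruxCycles

/-! ### Small separators in graphs without long cycles -/

section Separation

variable {V : Type*} (G : SimpleGraph V)

/-- The vertices `u` and `v` are joined by a walk of `G` all of whose vertices lie in `C`. -/
def JoinedWithin (C : Finset V) (u v : V) : Prop :=
  ∃ p : G.Walk u v, ∀ x ∈ p.support, x ∈ C

/-- `A` is a union of connected components of the subgraph induced on `C`. -/
def IsUnionOfComponents (C A : Finset V) : Prop :=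
  A ⊆ C ∧ ∀ x ∈ A, ∀ y ∈ C, G.Adj x y → y ∈ A

open Classical in
/-- The connected component of `u` in the subgraph induced on `C`. -/
noncomputable def componentWithin (C : Finset V) (u : V) : Finset V :=
  C.filter (JoinedWithin G C u)

variable {G} {C : Finset V} {u v w : V}

theorem JoinedWithin.symm (h : JoinedWithin G C u v) : JoinedWithin G C v u := by
  obtain ⟨p, hp⟩ := h
  exact ⟨p.reverse, by simpa using hp⟩

theorem JoinedWithin.trans (h : JoinedWithin G C u v) (h' : JoinedWithin G C v w) :
    JoinedWithin G C u w := by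
  obtain ⟨p, hp⟩ := h
  obtain ⟨q, hq⟩ := h'
  refine ⟨p.append q, fun x hx => ?_⟩
  rw [SimpleGraph.Walk.mem_support_append_iff] at hx
  exact hx.elim (hp x) (hq x)

theorem joinedWithin_of_adj (hu : u ∈ C) (hv : v ∈ C) (h : G.Adj u v) : JoinedWithin G C u v :=
  ⟨h.toWalk, by simp [hu, hv]⟩

theorem joinedWithin_self (hu : u ∈ C) : JoinedWithin G C u u :=
  ⟨.nil, by simp [hu]⟩

theorem componentWithin_subset : componentWithin G C u ⊆ C := by
  classical exact Finset.filter_subset _ _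

theorem mem_componentWithin :
    v ∈ componentWithin G C u ↔ v ∈ C ∧ JoinedWithin G C u v := by
  simp [componentWithin]

theorem isUnionOfComponents_componentWithin :
    IsUnionOfComponents G C (componentWithin G C u) := by
  refine ⟨componentWithin_subset, fun x hx y hy hxy => ?_⟩
  rw [mem_componentWithin] at hx ⊢
  exact ⟨hy, hx.2.trans (joinedWithin_of_adj hx.1 hy hxy)⟩

theorem joinedWithin_componentWithin (hv : v ∈ componentWithin G C u) :
    JoinedWithin G (componentWithin G C u) u v := by
  classical
  obtain ⟨p, hp⟩ := (mem_componentWithin.1 hv).2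
  refine ⟨p, fun x hx => mem_componentWithin.2 ⟨hp x hx, p.takeUntil x hx, fun y hy => ?_⟩⟩
  exact hp y (p.support_takeUntil_subset_support hx hy)

theorem componentWithin_subset_of_mem {A : Finset V} (hA : IsUnionOfComponents G C A)
    (hu : u ∈ A) : componentWithin G C u ⊆ A := by
  intro v hv
  obtain ⟨p, hp⟩ := (mem_componentWithin.1 hv).2
  clear hv
  induction p with
  | nil => exact hu
  | cons h p ih =>
    refine ih (hA.2 _ hu _ (hp _ ?_) h) fun x hx => hp x ?_
    · simp
    · simp [hx]

/-- Small components can be grouped into a union of components of controlled size. -/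
theorem exists_isUnionOfComponents_card_le {M : ℕ} (hM : M ≤ C.card)
    (hC : ∀ u ∈ C, (componentWithin G C u).card ≤ M) :
    ∃ A, IsUnionOfComponents G C A ∧ M ≤ A.card ∧ A.card ≤ 2 * M := by
  classical
  have hex : ∃ n, ∃ A, IsUnionOfComponents G C A ∧ M ≤ A.card ∧ A.card = n :=
    ⟨_, C, ⟨subset_rfl, fun _ _ _ hy _ => hy⟩, hM, rfl⟩
  -- Choose `A` of least size. If it exceeded `2M`, deleting one of its components, of size at most
  -- `M`, would leave a smaller admissible union.
  obtain ⟨A, hA, hMA, hcard⟩ := Nat.find_spec hex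
  refine ⟨A, hA, hMA, ?_⟩
  by_contra! hlt
  obtain ⟨u, hu⟩ : A.Nonempty := Finset.card_pos.1 (by omega)
  have hK := componentWithin_subset_of_mem hA hu
  have hKM := hC u (hA.1 hu)
  have huK : u ∈ componentWithin G C u :=
    mem_componentWithin.2 ⟨hA.1 hu, joinedWithin_self (hA.1 hu)⟩
  have hpos : 0 < (componentWithin G C u).card := Finset.card_pos.2 ⟨u, huK⟩
  have hsdiff := Finset.card_sdiff_add_card_eq_card hK
  refine Nat.find_min hex (m := (A \ componentWithin G C u).card) (by omega)
    ⟨_, ⟨Finset.sdiff_subset.trans hA.1, fun x hx y hy hxy => ?_⟩, by omega, rfl⟩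
  rw [Finset.mem_sdiff] at hx ⊢
  refine ⟨hA.2 x hx.1 y hy hxy, fun hyK => hx.2 ?_⟩
  exact isUnionOfComponents_componentWithin.2 y hyK x (hA.1 hx.1) hxy.symm

/-- If `x` is joined to the start `w` of a path avoiding `C` within `C ∪ {w}`, then in a graph
without cycles of length at least `L`, its neighbours on the path are among the first `L`
vertices. -/
theorem exists_getVert_eq_of_adj [DecidableEq V] {L : ℕ} (hL : 0 < L)
    (hcyc : ∀ (v : V) (c : G.Walk v v), c.IsCycle → c.length < L)
    {w z : V} {P : G.Walk w z} (hP : P.IsPath) (hdisj : ∀ x ∈ C, x ∉ P.support)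
    {x y : V} (hx : x ∈ C) (hjoin : JoinedWithin G (insert w C) x w)
    (hy : y ∈ P.support) (hxy : G.Adj x y) : ∃ i < L, P.getVert i = y := by
  by_cases hyw : y = w
  · exact ⟨0, hL, by simp [hyw]⟩
  refine ⟨(P.takeUntil y hy).length, ?_, P.getVert_length_takeUntil hy⟩
  obtain ⟨q, hq⟩ := hjoin
  have hxt : x ∉ (P.takeUntil y hy).support := fun h =>
    hdisj x hx (P.support_takeUntil_subset_support hy h)
  have htpos : 0 < (P.takeUntil y hy).length := by
    rw [Nat.pos_iff_ne_zero]
    exact fun h => hyw (SimpleGraph.Walk.eq_of_length_eq_zero h).symm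
  have ht : ((P.takeUntil y hy).concat hxy.symm).IsPath :=
    (hP.takeUntil hy).concat hxt hxy.symm
  have hw : w ∉ (P.takeUntil y hy).support.tail := by
    have h := (hP.takeUntil hy).support_nodup
    rw [← SimpleGraph.Walk.cons_tail_support] at h
    exact (List.nodup_cons.1 h).1
  -- The cycle runs from `x` to `w` through `C`, along `P` to `y`, and back by the edge `yx`. The
  -- second part has length at least 2 because `y ≠ w`, which excludes a doubled edge.
  have hcycle : (q.bypass.append ((P.takeUntil y hy).concat hxy.symm)).IsCycle := by
    refine q.bypass_isPath.isCycle_append ht ?_ (Or.inr (by simp; omega))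
    intro a ha hb
    have hxa : x ∉ q.bypass.support.tail := by
      have h := q.bypass_isPath.support_nodup
      rw [← SimpleGraph.Walk.cons_tail_support] at h
      exact (List.nodup_cons.1 h).1
    have haC := hq a (q.support_bypass_subset_support (List.mem_of_mem_tail ha))
    rw [SimpleGraph.Walk.support_concat,
      List.tail_append_of_ne_nil (by simp), List.mem_append, List.mem_singleton] at hb
    rcases hb with hb | rfl
    · rcases Finset.mem_insert.1 haC with rfl | haC
      · exact hw hb
      · exact hdisj a haC (P.support_takeUntil_subset_support hy (List.mem_of_mem_tail hb))
    · exact hxa ha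
  have := hcyc _ _ hcycle
  simp only [SimpleGraph.Walk.length_append, SimpleGraph.Walk.length_concat] at this
  omega

/-- Depth-first search: `w` is the tip of the current path `P`, and `C` is a region reachable from
the tip whose other neighbours in `U` all lie on `P`. If all components of `C` are small, grouping
them gives `A`, and the first `L` vertices of `P` counted from the tip serve as `S`. Otherwise the
path steps into a large component, and `C` shrinks. -/
theorem exists_separated_of_path [DecidableEq V] {L M : ℕ} (hL : 0 < L)
    (hcyc : ∀ (v : V) (c : G.Walk v v), c.IsCycle → c.length < L) (U : Finset V)
    {w z : V} (P : G.Walk w z) (hP : P.IsPath) (C : Finset V) (hCU : C ⊆ U)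
    (hdisj : ∀ x ∈ C, x ∉ P.support) (hjoin : ∀ x ∈ C, JoinedWithin G (insert w C) x w)
    (hnbr : ∀ x ∈ C, ∀ y ∈ U, G.Adj x y → y ∈ C ∨ y ∈ P.support) (hM : M ≤ C.card) :
    ∃ A S : Finset V, A ⊆ U ∧ M ≤ A.card ∧ A.card ≤ 2 * M ∧ S.card ≤ L ∧
      ∀ x ∈ A, ∀ y ∈ U, G.Adj x y → y ∈ A ∪ S := by
  induction hn : C.card using Nat.strong_induction_on generalizing w C with
  | _ n ih =>
  by_cases hsmall : ∀ u ∈ C, (componentWithin G C u).card ≤ M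
  · obtain ⟨A, hA, hMA, hAM⟩ := exists_isUnionOfComponents_card_le hM hsmall
    refine ⟨A, (Finset.range L).image P.getVert, hA.1.trans hCU, hMA, hAM,
      Finset.card_image_le.trans (by simp), fun x hx y hy hxy => ?_⟩
    rw [Finset.mem_union]
    rcases hnbr x (hA.1 hx) y hy hxy with h | h
    · exact Or.inl (hA.2 x hx y h hxy)
    · obtain ⟨i, hi, rfl⟩ :=
        exists_getVert_eq_of_adj hL hcyc hP hdisj (hA.1 hx) (hjoin x (hA.1 hx)) h hxy
      exact Or.inr (Finset.mem_image_of_mem _ (Finset.mem_range.2 hi))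
  · push Not at hsmall
    obtain ⟨u, hu, hMK⟩ := hsmall
    obtain ⟨w', hw', hadj⟩ : ∃ w' ∈ componentWithin G C u, G.Adj w w' := by
      obtain ⟨q, hq⟩ := hjoin u hu
      have hpath : q.bypass.reverse.IsPath := q.bypass_isPath.reverse
      have hsupp : ∀ x ∈ q.bypass.reverse.support, x ∈ insert w C := fun x hx =>
        hq x (q.support_bypass_subset_support (by simpa using hx))
      generalize q.bypass.reverse = q' at hpath hsupp
      cases q' with
      | nil => exact absurd P.start_mem_support (hdisj _ hu)
      | cons h q' =>
        rw [SimpleGraph.Walk.cons_isPath_iff] at hpath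
        have hC : ∀ x ∈ q'.support, x ∈ C := fun x hx =>
          Finset.mem_of_mem_insert_of_ne (hsupp x (by simp [hx]))
            (fun hxw => hpath.2 (hxw ▸ hx))
        exact ⟨_, mem_componentWithin.2 ⟨hC _ q'.start_mem_support,
          JoinedWithin.symm ⟨q', hC⟩⟩, h⟩
    set K := componentWithin G C u with hK
    have hKC : K ⊆ C := componentWithin_subset
    have hcard := Finset.card_erase_of_mem hw'
    have hle := Finset.card_le_card hKC
    -- The component has more than `M` vertices, so at least `M` remain once `w'` joins the path.
    refine ih (K.erase w').card (by omega) (.cons hadj.symm P)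
      (hP.cons (hdisj _ (hKC hw'))) (K.erase w')
      ((Finset.erase_subset _ _).trans (hKC.trans hCU)) ?_ ?_ ?_ (by omega) rfl
    · intro x hx
      rw [Finset.mem_erase] at hx
      simp [hx.1, hdisj x (hKC hx.2)]
    · intro x hx
      rw [Finset.insert_erase hw']
      exact (joinedWithin_componentWithin (Finset.mem_of_mem_erase hx)).symm.trans
        (joinedWithin_componentWithin hw')
    · intro x hx y hy hxy
      have hxK := Finset.mem_of_mem_erase hx
      rw [SimpleGraph.Walk.support_cons, List.mem_cons, Finset.mem_erase]
      by_cases hyw : y = w'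
      · exact Or.inr (Or.inl hyw)
      rcases hnbr x (hKC hxK) y hy hxy with h | h
      · exact Or.inl ⟨hyw, isUnionOfComponents_componentWithin.2 x hxK y h hxy⟩
      · exact Or.inr (Or.inr h)

/-- In a graph without cycles of length at least `L`, every large set of vertices has a subset
of controlled size with at most `L` outside neighbours. -/
theorem exists_separated [DecidableEq V] {L M : ℕ} (hL : 0 < L)
    (hcyc : ∀ (v : V) (c : G.Walk v v), c.IsCycle → c.length < L) (U : Finset V)
    (hM : M ≤ U.card) :
    ∃ A S : Finset V, A ⊆ U ∧ M ≤ A.card ∧ A.card ≤ 2 * M ∧ S.card ≤ L ∧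
      ∀ x ∈ A, ∀ y ∈ U, G.Adj x y → y ∈ A ∪ S := by
  by_cases hsmall : ∀ u ∈ U, (componentWithin G U u).card ≤ M
  · obtain ⟨A, hA, hMA, hAM⟩ := exists_isUnionOfComponents_card_le hM hsmall
    exact ⟨A, ∅, hA.1, hMA, hAM, by simp, fun x hx y hy hxy => by simpa using hA.2 x hx y hy hxy⟩
  · push Not at hsmall
    obtain ⟨w, hw, hMK⟩ := hsmall
    set K := componentWithin G U w with hK
    have hKU : K ⊆ U := componentWithin_subset
    have hwK : w ∈ K := mem_componentWithin.2 ⟨hw, joinedWithin_self hw⟩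
    have hcard := Finset.card_erase_of_mem hwK
    refine exists_separated_of_path hL hcyc U (.nil : G.Walk w w) .nil (K.erase w)
      ((Finset.erase_subset _ _).trans hKU) ?_ ?_ ?_ (by omega)
    · intro x hx
      simpa using Finset.ne_of_mem_erase hx
    · intro x hx
      rw [Finset.insert_erase hwK]
      exact (joinedWithin_componentWithin (Finset.mem_of_mem_erase hx)).symm
    · intro x hx y hy hxy
      rw [Finset.mem_erase, SimpleGraph.Walk.support_nil, List.mem_singleton]
      have := isUnionOfComponents_componentWithin.2 x (Finset.mem_of_mem_erase hx) y hy hxy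
      tauto

/-- In a graph without long cycles, a density bound for small vertex sets gives almost the same
bound for all vertex sets. -/
theorem card_interedges_le_of_no_long_cycle [DecidableEq V] [DecidableRel G.Adj] {L M : ℕ}
    (hL : 0 < L) (hM : 0 < M) (hcyc : ∀ (v : V) (c : G.Walk v v), c.IsCycle → c.length < L)
    {D : ℝ} (hD : 0 ≤ D)
    (hsparse : ∀ T : Finset V, T.card ≤ 2 * M + L → ((G.interedges T T).card : ℝ) ≤ D * T.card)
    (U : Finset V) : ((G.interedges U U).card : ℝ) ≤ D * (1 + L / M) * U.card := by
  have hM' : (0 : ℝ) < M := by exact_mod_cast hM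
  induction hn : U.card using Nat.strong_induction_on generalizing U with
  | _ n ih =>
  subst hn
  by_cases hUM : U.card < M
  · refine (hsparse U (by omega)).trans ?_
    have : 0 ≤ D * (L / M) * U.card := by positivity
    linarith
  · obtain ⟨A, S, hAU, hMA, hAM, hS, hAS⟩ := exists_separated hL hcyc U (not_lt.1 hUM)
    have hsub : G.interedges U U ⊆ G.interedges (A ∪ S) (A ∪ S) ∪
        G.interedges (U \ A) (U \ A) := by
      rintro ⟨x, y⟩ hxy
      rw [SimpleGraph.mk_mem_interedges_iff] at hxy
      rw [Finset.mem_union, SimpleGraph.mk_mem_interedges_iff, SimpleGraph.mk_mem_interedges_iff]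
      obtain ⟨hx, hy, hadj⟩ := hxy
      by_cases hxA : x ∈ A
      · exact Or.inl ⟨Finset.mem_union_left _ hxA, hAS x hxA y hy hadj, hadj⟩
      by_cases hyA : y ∈ A
      · exact Or.inl ⟨hAS y hyA x hx hadj.symm, Finset.mem_union_left _ hyA, hadj⟩
      · exact Or.inr ⟨Finset.mem_sdiff.2 ⟨hx, hxA⟩, Finset.mem_sdiff.2 ⟨hy, hyA⟩, hadj⟩
    have hle : ((G.interedges U U).card : ℝ) ≤ (G.interedges (A ∪ S) (A ∪ S)).card +
        (G.interedges (U \ A) (U \ A)).card := by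
      exact_mod_cast (Finset.card_le_card hsub).trans (Finset.card_union_le _ _)
    have hunion := Finset.card_union_le A S
    have h1 := hsparse (A ∪ S) (by omega)
    have hsd := Finset.card_sdiff_add_card_eq_card hAU
    have h2 := ih (U \ A).card (by omega) (U \ A) rfl
    have hsd' : (U.card : ℝ) = (U \ A).card + A.card := by exact_mod_cast hsd.symm
    have hASL : ((A ∪ S).card : ℝ) ≤ A.card + L := by
      exact_mod_cast hunion.trans (by omega)
    -- Since `|A| ≥ M`, the at most `L` extra vertices of `S` are paid for by `A`.
    have hLA : (L : ℝ) ≤ L / M * A.card := by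
      rw [div_mul_eq_mul_div, le_div_iff₀ hM']
      have : (M : ℝ) ≤ A.card := by exact_mod_cast hMA
      gcongr
    have h3 : D * (A ∪ S).card ≤ D * ((1 + L / M) * A.card) := by
      gcongr
      linarith
    rw [hsd']
    linarith

end Separation

end CruxCycles

namespace CruxCycles

/-! ### Edge-isoperimetry via entropy -/

section Isoperimetry

/-- Subadditivity of entropy for the uniform distribution on a finite set. -/
theorem sum_card_fiber_mul_log_le {α J Y : Type*} [Fintype J] [Fintype Y] [DecidableEq J]
    [DecidableEq Y] (S : Finset α) (g : α → J) (h : α → Y)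
    (hinj : Function.Injective fun x => (g x, h x)) :
    ∑ j, ((S.filter (g · = j)).card : ℝ) * Real.log (S.filter (g · = j)).card +
      ∑ y, ((S.filter (h · = y)).card : ℝ) * Real.log (S.filter (h · = y)).card ≤
      S.card * Real.log S.card := by
  set a : J → ℝ := fun j => ((S.filter (g · = j)).card : ℝ) with ha
  set k : Y → ℝ := fun y => ((S.filter (h · = y)).card : ℝ) with hk
  have hsuma : ∑ j, a j = S.card := by
    rw [Finset.card_eq_sum_card_fiberwise (f := g) (t := Finset.univ) (by simp), Nat.cast_sum]
  have hsumk : ∑ y, k y = S.card := by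
    rw [Finset.card_eq_sum_card_fiberwise (f := h) (t := Finset.univ) (by simp), Nat.cast_sum]
  have hloga : ∑ j, a j * Real.log (a j) = ∑ x ∈ S, Real.log (a (g x)) := by
    rw [← Finset.sum_fiberwise S g]
    refine Finset.sum_congr rfl fun j _ => ?_
    rw [Finset.sum_congr rfl fun x hx => by rw [(Finset.mem_filter.1 hx).2],
      Finset.sum_const, nsmul_eq_mul]
  have hlogk : ∑ y, k y * Real.log (k y) = ∑ x ∈ S, Real.log (k (h x)) := by
    rw [← Finset.sum_fiberwise S h]
    refine Finset.sum_congr rfl fun j _ => ?_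
    rw [Finset.sum_congr rfl fun x hx => by rw [(Finset.mem_filter.1 hx).2],
      Finset.sum_const, nsmul_eq_mul]
  change ∑ j, a j * Real.log (a j) + ∑ y, k y * Real.log (k y) ≤ _
  rw [hloga, hlogk]
  rcases S.eq_empty_or_nonempty with rfl | hS
  · simp
  have hSpos : (0 : ℝ) < S.card := by exact_mod_cast hS.card_pos
  -- Injectivity embeds `S` in `J × Y`, over which the sum factorises.
  have hprod : ∑ x ∈ S, a (g x) * k (h x) ≤ S.card * S.card := by
    calc ∑ x ∈ S, a (g x) * k (h x)
        = ∑ p ∈ S.map ⟨_, hinj⟩, a p.1 * k p.2 := by rw [Finset.sum_map]; rfl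
      _ ≤ ∑ p : J × Y, a p.1 * k p.2 :=
          Finset.sum_le_univ_sum_of_nonneg fun p => by positivity
      _ = S.card * S.card := by
          rw [Fintype.sum_prod_type, ← Finset.sum_mul_sum, hsuma, hsumk]
  -- Gibbs' inequality: `log t ≤ t - 1` at `t = a k / |S|`; summed over `S`, the error is
  -- nonpositive by `hprod`.
  have hterm : ∀ x ∈ S, Real.log (a (g x)) + Real.log (k (h x)) ≤
      Real.log S.card + (a (g x) * k (h x) / S.card - 1) := by
    intro x hx
    have hapos : 0 < a (g x) := by
      simp only [ha]
      exact_mod_cast Finset.card_pos.2 ⟨x, by simp [hx]⟩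
    have hkpos : 0 < k (h x) := by
      simp only [hk]
      exact_mod_cast Finset.card_pos.2 ⟨x, by simp [hx]⟩
    have := Real.log_le_sub_one_of_pos (x := a (g x) * k (h x) / S.card) (by positivity)
    rw [Real.log_div (by positivity) (by positivity), Real.log_mul hapos.ne' hkpos.ne'] at this
    linarith
  calc ∑ x ∈ S, Real.log (a (g x)) + ∑ x ∈ S, Real.log (k (h x))
      ≤ ∑ x ∈ S, (Real.log S.card + (a (g x) * k (h x) / S.card - 1)) := by
        rw [← Finset.sum_add_distrib]; exact Finset.sum_le_sum hterm
    _ = S.card * Real.log S.card + ((∑ x ∈ S, a (g x) * k (h x)) / S.card - S.card) := by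
        simp [Finset.sum_add_distrib, Finset.sum_sub_distrib, Finset.sum_div]
    _ ≤ S.card * Real.log S.card := by
        have : (∑ x ∈ S, a (g x) * k (h x)) / S.card ≤ S.card := by
          rw [div_le_iff₀ hSpos]; exact hprod
        linarith

/-- The chord of the logarithm between `1` and `r`. -/
theorem sub_one_mul_log_le {x r : ℝ} (hx : 1 ≤ x) (hxr : x ≤ r) :
    (x - 1) * Real.log r ≤ (r - 1) * Real.log x := by
  rcases hxr.eq_or_lt with rfl | hlt
  · rfl
  have hr : 0 < r - 1 := by linarith
  have hconc := strictConcaveOn_log_Ioi.concaveOn.2 (show (1 : ℝ) ∈ Set.Ioi 0 by simp)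
    (show r ∈ Set.Ioi 0 by simp; linarith)
    (show 0 ≤ (r - x) / (r - 1) from div_nonneg (by linarith) hr.le)
    (show 0 ≤ (x - 1) / (r - 1) from div_nonneg (by linarith) hr.le)
    (by rw [← add_div, div_eq_one_iff_eq hr.ne']; ring)
  simp only [smul_eq_mul, Real.log_one, mul_zero, zero_add] at hconc
  have hx' : (r - x) / (r - 1) * 1 + (x - 1) / (r - 1) * r = x := by
    field_simp; ring
  rw [hx', div_mul_eq_mul_div, div_le_iff₀ hr] at hconc
  linarith

open Classical in
/-- The edge-isoperimetric inequality in Hamming graphs. -/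
theorem card_interedges_hammingGraph_mul_log_le (m r : ℕ) (S : Finset (Fin m → Fin r)) :
    (((hammingGraph m r).interedges S S).card : ℝ) * Real.log r ≤
      (r - 1) * (S.card * Real.log S.card) := by
  induction m with
  | zero =>
    have hcard : S.card ≤ 1 := Finset.card_le_one_of_subsingleton S
    have hempty : (hammingGraph 0 r).interedges S S = ∅ := by
      refine Finset.eq_empty_of_forall_notMem fun p hp => ?_
      obtain ⟨-, -, i, -⟩ := (SimpleGraph.mem_interedges_iff _).1 hp
      exact i.elim0
    rw [hempty]
    interval_cases S.card <;> simp
  | succ m ih =>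
    rcases S.eq_empty_or_nonempty with rfl | ⟨x₀, hx₀⟩
    · simp
    have hr : (1 : ℝ) ≤ r := by exact_mod_cast (x₀ 0).pos
    have hlogr : 0 ≤ Real.log r := Real.log_nonneg hr
    set A : Fin r → Finset (Fin (m + 1) → Fin r) := fun j => S.filter (· 0 = j) with hA
    set K : (Fin m → Fin r) → Finset (Fin (m + 1) → Fin r) :=
      fun y => S.filter (Fin.tail · = y) with hK
    set B : Fin r → Finset (Fin m → Fin r) := fun j => (A j).image Fin.tail with hB
    have hinj : Function.Injective
        fun x : Fin (m + 1) → Fin r => (x 0, (Fin.tail x : Fin m → Fin r)) := by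
      intro x y hxy
      rw [Prod.mk.injEq] at hxy
      rw [← Fin.cons_self_tail x, ← Fin.cons_self_tail y, hxy.1, hxy.2]
    have hcardB : ∀ j, (B j).card = (A j).card := by
      refine fun j => Finset.card_image_of_injOn fun x hx y hy hxy => hinj ?_
      simp only [hA, Finset.coe_filter, Set.mem_ofPred_eq] at hx hy
      simp [hx.2, hy.2, hxy]
    -- Adjacent pairs differing in coordinate `0` share a tail; all others lie in one layer, a copy
    -- of `H(m,r)`.
    have hcover : (hammingGraph (m + 1) r).interedges S S ⊆
        (Finset.univ.biUnion fun j => ((hammingGraph m r).interedges (B j) (B j)).image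
          fun p => ((Fin.cons j p.1, Fin.cons j p.2) :
            (Fin (m + 1) → Fin r) × (Fin (m + 1) → Fin r))) ∪
        Finset.univ.biUnion fun y => (K y).offDiag := by
      rintro ⟨x, y⟩ hxy
      rw [SimpleGraph.mk_mem_interedges_iff] at hxy
      obtain ⟨hx, hy, i, hi, hne⟩ := hxy
      rw [Finset.mem_union]
      induction i using Fin.cases with
      | zero =>
        right
        have htail : Fin.tail x = Fin.tail y := funext fun j => hne j.succ (Fin.succ_ne_zero j)
        refine Finset.mem_biUnion.2 ⟨Fin.tail y, Finset.mem_univ _, Finset.mem_offDiag.2 ?_⟩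
        simp only [hK, Finset.mem_filter]
        exact ⟨⟨hx, htail⟩, ⟨hy, trivial⟩, fun h => hi.ne (congrFun h 0)⟩
      | succ i =>
        left
        have h0 : x 0 = y 0 := hne 0 (Fin.succ_ne_zero i).symm
        refine Finset.mem_biUnion.2 ⟨x 0, Finset.mem_univ _, Finset.mem_image.2
          ⟨(Fin.tail x, Fin.tail y), ?_, ?_⟩⟩
        · rw [SimpleGraph.mk_mem_interedges_iff]
          refine ⟨Finset.mem_image_of_mem _ ?_, Finset.mem_image_of_mem _ ?_, i, hi,
            fun j hj => hne j.succ (by simpa using hj)⟩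
          · simp [hA, hx]
          · simp [hA, hy, h0]
        · rw [Prod.mk.injEq]
          refine ⟨Fin.cons_self_tail x, ?_⟩
          rw [h0]
          exact Fin.cons_self_tail y
    have hcount : (((hammingGraph (m + 1) r).interedges S S).card : ℝ) ≤
        ∑ j, (((hammingGraph m r).interedges (B j) (B j)).card : ℝ) +
          ∑ y, ((K y).card : ℝ) * ((K y).card - 1) := by
      have h1 := (Finset.card_le_card hcover).trans (Finset.card_union_le _ _)
      have h2 := h1.trans (Nat.add_le_add
        (Finset.card_biUnion_le.trans (Finset.sum_le_sum fun j _ => Finset.card_image_le))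
        Finset.card_biUnion_le)
      have h3 : ∀ y, ((K y).offDiag.card : ℝ) = ((K y).card : ℝ) * ((K y).card - 1) := by
        intro y
        rw [Finset.offDiag_card, Nat.cast_sub (Nat.le_mul_self _)]
        push_cast
        ring
      rw [← Finset.sum_congr rfl fun y _ => h3 y]
      exact_mod_cast h2
    -- A fibre of the tail is a clique on at most `r` vertices, so concavity of the logarithm
    -- suffices.
    have hK' : ∀ y, ((K y).card : ℝ) * ((K y).card - 1) * Real.log r ≤
        (r - 1) * ((K y).card * Real.log (K y).card) := by
      intro y
      rcases Nat.eq_zero_or_pos (K y).card with h0 | hpos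
      · simp [h0]
      have hle : (K y).card ≤ r := by
        have : (K y).card ≤ (Finset.univ : Finset (Fin r)).card := by
          refine Finset.card_le_card_of_injOn (· 0) (by simp) fun u hu v hv huv => hinj ?_
          simp only [hK, Finset.coe_filter, Set.mem_ofPred_eq] at hu hv
          simp only at huv
          simp [hu.2, hv.2, huv]
        simpa using this
      have := sub_one_mul_log_le (x := (K y).card) (r := r) (by exact_mod_cast hpos)
        (by exact_mod_cast hle)
      have := mul_le_mul_of_nonneg_left this (Nat.cast_nonneg (K y).card)
      linarith
    have hent := sum_card_fiber_mul_log_le S (fun x => x 0)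
      (fun x => (Fin.tail x : Fin m → Fin r)) hinj
    calc (((hammingGraph (m + 1) r).interedges S S).card : ℝ) * Real.log r
        ≤ (∑ j, (((hammingGraph m r).interedges (B j) (B j)).card : ℝ) +
          ∑ y, ((K y).card : ℝ) * ((K y).card - 1)) * Real.log r := by gcongr
      _ = ∑ j, (((hammingGraph m r).interedges (B j) (B j)).card : ℝ) * Real.log r +
          ∑ y, ((K y).card : ℝ) * ((K y).card - 1) * Real.log r := by
          rw [add_mul, Finset.sum_mul, Finset.sum_mul]
      _ ≤ ∑ j, ((r : ℝ) - 1) * ((A j).card * Real.log (A j).card) +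
          ∑ y, ((r : ℝ) - 1) * ((K y).card * Real.log (K y).card) := by
          refine add_le_add (Finset.sum_le_sum fun j _ => ?_) (Finset.sum_le_sum fun y _ => hK' y)
          rw [← hcardB]
          exact ih (B j)
      _ ≤ (r - 1) * (S.card * Real.log S.card) := by
          rw [← Finset.mul_sum, ← Finset.mul_sum, ← mul_add]
          exact mul_le_mul_of_nonneg_left hent (by linarith)

end Isoperimetry

end CruxCycles

namespace CruxCycles

/-! ### From sparsity to long cycles -/

section LongCycles

open Classical in
/-- Vertex sets of subgraphs of Hamming graphs span few edges. -/
theorem card_interedges_le_of_injective {V : Type*} {G : SimpleGraph V} {m r : ℕ} (hr : 2 ≤ r)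
    (φ : G →g hammingGraph m r) (hφ : Function.Injective φ) (T : Finset V) :
    ((G.interedges T T).card : ℝ) ≤ (r - 1) * (Real.log T.card / Real.log r) * T.card := by
  have hlogr : 0 < Real.log r := Real.log_pos (by exact_mod_cast hr)
  have hle : (G.interedges T T).card ≤
      ((hammingGraph m r).interedges (T.image φ) (T.image φ)).card := by
    refine Finset.card_le_card_of_injOn (Prod.map φ φ) (fun p hp => ?_)
      (hφ.prodMap hφ).injOn
    obtain ⟨h1, h2, h3⟩ := (SimpleGraph.mem_interedges_iff _).1 (Finset.mem_coe.1 hp)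
    exact Finset.mem_coe.2 ((SimpleGraph.mem_interedges_iff _).2
      ⟨Finset.mem_image_of_mem _ h1, Finset.mem_image_of_mem _ h2, φ.map_adj h3⟩)
  have h := card_interedges_hammingGraph_mul_log_le m r (T.image φ)
  rw [Finset.card_image_of_injective _ hφ, ← le_div_iff₀ hlogr] at h
  calc ((G.interedges T T).card : ℝ) ≤ _ := Nat.cast_le.2 hle
    _ ≤ _ := h
    _ = _ := by ring

open Classical in
/-- Subgraphs of Hamming graphs without long cycles are sparse. -/
theorem card_interedges_univ_le_of_no_long_cycle {V : Type*} [Fintype V] {G : SimpleGraph V}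
    {m r : ℕ} (hr : 2 ≤ r) (φ : G →g hammingGraph m r) (hφ : Function.Injective φ) {L k : ℕ}
    (hL : 0 < L) (hk : 0 < k) (hcyc : ∀ (v : V) (c : G.Walk v v), c.IsCycle → c.length < L) :
    ((G.interedges Finset.univ Finset.univ).card : ℝ) ≤
      (r - 1) * (Real.log ((2 * k + 1) * L) / Real.log r) * (1 + 1 / k) * Fintype.card V := by
  have hr1 : (1 : ℝ) < r := by exact_mod_cast hr
  have hlogr : 0 < Real.log r := Real.log_pos hr1
  have hL1 : (1 : ℝ) ≤ L := by exact_mod_cast hL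
  have hk1 : (1 : ℝ) ≤ k := by exact_mod_cast hk
  have hlog : 0 ≤ Real.log ((2 * k + 1) * L) := Real.log_nonneg (by nlinarith)
  have h := card_interedges_le_of_no_long_cycle (G := G) hL (Nat.mul_pos hk hL) hcyc
    (D := (r - 1) * (Real.log ((2 * k + 1) * L) / Real.log r))
    (mul_nonneg (by linarith) (by positivity)) (fun T hT => ?_) Finset.univ
  · have hdiv : (L : ℝ) / ((k * L : ℕ) : ℝ) = 1 / k := by
      push_cast
      field_simp
    rwa [hdiv] at h
  · refine (card_interedges_le_of_injective hr φ hφ T).trans ?_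
    rcases T.eq_empty_or_nonempty with rfl | hT0
    · simp
    have hTpos : (0 : ℝ) < T.card := by exact_mod_cast hT0.card_pos
    have hTle : (T.card : ℝ) ≤ (2 * k + 1) * L := by
      have : (T.card : ℝ) ≤ ((2 * (k * L) + L : ℕ) : ℝ) := by exact_mod_cast hT
      push_cast at this
      linarith
    have hr0 : (0 : ℝ) ≤ r - 1 := by linarith
    gcongr

/-- A forest extends to a spanning tree of the complete graph. -/
theorem card_edgeFinset_add_one_le_of_isAcyclic {V : Type*} [Fintype V] [Nonempty V]
    {G : SimpleGraph V} [Fintype G.edgeSet] (hG : G.IsAcyclic) :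
    G.edgeFinset.card + 1 ≤ Fintype.card V := by
  classical
  obtain ⟨F, hGF, hF⟩ := SimpleGraph.exists_maximal_isAcyclic_of_le_isAcyclic (G := ⊤) le_top hG
  have hFtree : F.IsTree := SimpleGraph.maximal_isAcyclic_iff_isTree.1 (by simpa using hF)
  rw [← hFtree.card_edgeFinset]
  exact Nat.add_le_add_right (Finset.card_le_card (SimpleGraph.edgeFinset_mono hGF)) 1

open Classical in
theorem card_interedges_univ {V : Type*} [Fintype V] (G : SimpleGraph V) :
    (G.interedges Finset.univ Finset.univ).card = 2 * G.edgeFinset.card := by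
  rw [← G.sum_degrees_eq_twice_card_edges,
    Finset.card_eq_sum_card_fiberwise (f := Prod.fst) (t := Finset.univ) (by simp)]
  refine Finset.sum_congr rfl fun v _ => ?_
  rw [← G.card_neighborFinset_eq_degree]
  refine Finset.card_bij' (fun p _ => p.2) (fun w _ => (v, w)) ?_ ?_ ?_ ?_
  · rintro ⟨x, y⟩ hp
    simp only [Finset.mem_filter, SimpleGraph.mk_mem_interedges_iff] at hp
    simpa [hp.2] using hp.1.2.2
  · intro w hw
    simpa [SimpleGraph.mk_mem_interedges_iff] using hw
  · rintro ⟨x, y⟩ hp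
    simp only [Finset.mem_filter] at hp
    simp [hp.2]
  · intro w _
    rfl

open Classical in
theorem averageDegree_eq {V : Type*} [Fintype V] {G : SimpleGraph V} (H : G.Subgraph) :
    averageDegree H = 2 * (H.coe.edgeFinset.card : ℝ) / Fintype.card H.verts := by
  have hedge : H.edgeSet.ncard = H.coe.edgeFinset.card := by
    rw [← H.image_coe_edgeSet_coe,
      Set.ncard_image_of_injective _ (Sym2.map.injective Subtype.val_injective),
      ← SimpleGraph.coe_edgeFinset, Set.ncard_coe_finset]
  rw [averageDegree, hedge, ← Nat.card_coe_set_eq, Nat.card_eq_fintype_card]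

/-- The loss in the exponent. -/
noncomputable def exponentError (d : ℝ) : ℝ := 5 * √d + 7

theorem exponentError_isLittleO : exponentError =o[atTop] (fun d : ℝ => d) := by
  have hconst : (fun _ : ℝ => (7 : ℝ)) =o[atTop] (fun d : ℝ => d) :=
    isLittleO_const_id_atTop 7
  refine IsLittleO.add (IsLittleO.const_mul_left ?_ 5) hconst
  refine (isLittleO_iff_tendsto' ?_).2 ?_
  · filter_upwards [eventually_gt_atTop 0] with d hd h0 using absurd h0 hd.ne'
  · simpa [Real.sqrt_div_self, Function.comp_def] using tendsto_inv_atTop_zero.comp Real.tendsto_sqrt_atTop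

/-- The hypothesis is used at `k` just above `√d`, where both the factor `1 + 1/k` and the term
`log(2k+1)` cost `O(√d)` in the exponent. The `- 1` reserves one factor `r` for rounding `L` up to
an integer. -/
theorem exponent_le_of_le {d r : ℝ} {L : ℕ} (hd : 0 ≤ d) (hr : 2 ≤ r) (hL : 0 < L)
    (h : ∀ k : ℕ, 0 < k →
      d ≤ (r - 1) * (Real.log ((2 * k + 1) * L) / Real.log r) * (1 + 1 / k)) :
    (d / (r - 1) - (exponentError d - 1)) * Real.log r < Real.log L := by
  have hlogr : 0 < Real.log r := Real.log_pos (by linarith)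
  have hlog2 : Real.log 2 ≤ Real.log r := Real.log_le_log (by norm_num) hr
  have hL0 : (0 : ℝ) < L := by exact_mod_cast hL
  set s := √d with hs
  have hs0 : 0 ≤ s := Real.sqrt_nonneg d
  have hss : s * s = d := Real.mul_self_sqrt hd
  set k := ⌊s⌋₊ + 1 with hk
  have hsk : s < k := by rw [hk]; exact_mod_cast Nat.lt_floor_add_one s
  have hks : (k : ℝ) ≤ s + 1 := by
    rw [hk]; push_cast; linarith [Nat.floor_le hs0]
  have hk0 : (0 : ℝ) < k := by rw [hk]; positivity
  have hr1 : 0 < r - 1 := by linarith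
  have hkk := h k (Nat.succ_pos _)
  rw [Real.log_mul (by positivity) hL0.ne'] at hkk
  -- This crude linear bound is enough, as `k` is only of order `√d`.
  have hlogk : Real.log (2 * k + 1) ≤ (2 * k + 1) * Real.log r := by
    have h1 : Real.log (2 * k + 1) ≤ (2 * k + 1) * Real.log 2 := by
      have h2 : (2 * (k : ℝ) + 1) ≤ 2 ^ (2 * k + 1) := by
        exact_mod_cast (Nat.lt_two_pow_self (n := 2 * k + 1)).le
      have h3 := Real.log_le_log (by positivity) h2
      rw [Real.log_pow] at h3
      exact_mod_cast h3
    exact h1.trans (by gcongr)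
  have hmain : d / (r - 1) * Real.log r * (k / (k + 1)) ≤
      Real.log (2 * k + 1) + Real.log L := by
    have : d ≤ (Real.log (2 * k + 1) + Real.log L) * ((r - 1) * (k + 1) / (Real.log r * k)) := by
      refine hkk.trans_eq ?_
      field_simp
    rw [← div_le_iff₀ (by positivity)] at this
    refine le_trans (le_of_eq ?_) this
    field_simp
  have hloss : d / (r - 1) * (1 / (k + 1)) ≤ s := by
    have h1 : d / (r - 1) ≤ d := div_le_self hd (by linarith)
    have h2 : d * (1 / (k + 1)) ≤ s := by
      rw [mul_one_div, div_le_iff₀ (by positivity)]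
      nlinarith
    exact (mul_le_mul_of_nonneg_right h1 (by positivity)).trans h2
  have hsplit : d / (r - 1) * Real.log r = d / (r - 1) * Real.log r * (k / (k + 1)) +
      d / (r - 1) * (1 / (k + 1)) * Real.log r := by
    field_simp
  have hf : exponentError d - 1 = 5 * s + 6 := by rw [exponentError]; ring
  rw [hf]
  nlinarith [mul_le_mul_of_nonneg_right hloss hlogr.le,
    mul_le_mul_of_nonneg_right hks hlogr.le, mul_nonneg hs0 hlogr.le]

/-- Subgraphs of Cartesian powers of an `r`-vertex graph contain long cycles. -/
theorem exists_isCycle_rpow_le_length {m r : ℕ} (hr : 2 ≤ r) (Q : SimpleGraph (Fin r))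
    (H : (cartesianPower Q m).Subgraph) (hd : 2 ≤ averageDegree H) :
    ∃ (v : H.verts) (c : H.coe.Walk v v), c.IsCycle ∧
      (r : ℝ) ^ (averageDegree H / ((r : ℝ) - 1) - exponentError (averageDegree H)) ≤
        (c.length : ℝ) := by
  classical
  set d := averageDegree H with hdef
  have hr2 : (2 : ℝ) ≤ r := by exact_mod_cast hr
  have havg := averageDegree_eq H
  rw [← hdef] at havg
  have hcard : 0 < Fintype.card H.verts := by
    rw [Nat.pos_iff_ne_zero]
    intro h0
    rw [h0, Nat.cast_zero, div_zero] at havg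
    linarith
  have hcard' : (0 : ℝ) < Fintype.card H.verts := by exact_mod_cast hcard
  have hne : Nonempty H.verts := Fintype.card_pos_iff.1 hcard
  rw [eq_div_iff hcard'.ne'] at havg
  set x := (r : ℝ) ^ (d / ((r : ℝ) - 1) - exponentError d) with hx
  have hx0 : 0 < x := Real.rpow_pos_of_pos (by linarith) _
  by_contra! hno
  -- A forest has average degree below 2, so some cycle exists; as it is too short, `x > 3`. This
  -- makes `⌈x⌉ ≤ x + 1 ≤ r x`.
  obtain ⟨v, c, hc⟩ : ∃ (v : H.verts) (c : H.coe.Walk v v), c.IsCycle := by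
    by_contra! hacyc
    have h1 := card_edgeFinset_add_one_le_of_isAcyclic (G := H.coe) fun v c => hacyc v c
    have h2 : (H.coe.edgeFinset.card : ℝ) + 1 ≤ Fintype.card H.verts := by exact_mod_cast h1
    nlinarith
  have hx1 : 1 ≤ x := by
    have h1 : (3 : ℝ) ≤ c.length := by exact_mod_cast hc.three_le_length
    linarith [hno v c hc]
  have hL : 0 < ⌈x⌉₊ := Nat.ceil_pos.2 hx0
  let φ : H.coe →g hammingGraph m r :=
    ⟨Subtype.val, fun {a b} hab => by
      obtain ⟨i, hi, h⟩ := H.adj_sub hab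
      exact ⟨i, hi.ne, h⟩⟩
  have hexp := exponent_le_of_le (d := d) (r := r) (L := ⌈x⌉₊) (by linarith) hr2 hL
    fun k hk => ?_
  · have hLx : ((⌈x⌉₊ : ℕ) : ℝ) ≤ r * x := by
      have := (Nat.ceil_lt_add_one hx0.le).le
      nlinarith
    have h1 := Real.log_le_log (by exact_mod_cast hL) hLx
    rw [Real.log_mul (by linarith) hx0.ne', hx, Real.log_rpow (by linarith)] at h1
    rw [hx] at hexp
    linarith
  · have h := card_interedges_univ_le_of_no_long_cycle hr φ Subtype.val_injective hL hk
      fun v c hc => by exact_mod_cast (hno v c hc).trans_le (Nat.le_ceil x)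
    refine le_of_mul_le_mul_right (havg.trans_le (le_trans (le_of_eq ?_) h)) hcard'
    rw [card_interedges_univ]
    push_cast
    congr!

end LongCycles

end CruxCycles

/-- The error function `f`, with `f d = o(d)` as `d → ∞`, depends on neither `m` nor `r`
nor the subgraph. -/
theorem corollary1p7 :
    ∃ f : ℝ → ℝ, f =o[atTop] (fun d : ℝ => d) ∧
      (∀ (m r : ℕ), 2 ≤ r → ∀ H : (CruxCycles.hammingGraph m r).Subgraph,
        2 ≤ CruxCycles.averageDegree H →
          ∃ (v : H.verts) (c : H.coe.Walk v v), c.IsCycle ∧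
            (r : ℝ) ^ (CruxCycles.averageDegree H / ((r : ℝ) - 1) -
              f (CruxCycles.averageDegree H)) ≤ (c.length : ℝ)) ∧
      (∀ (m : ℕ) (H : (CruxCycles.discreteTorus m).Subgraph), H.verts.Nonempty →
        (2 ≤ CruxCycles.averageDegree H →
          ∃ (v : H.verts) (c : H.coe.Walk v v), c.IsCycle ∧
            (3 : ℝ) ^ (CruxCycles.averageDegree H / 2 -
              f (CruxCycles.averageDegree H)) ≤ (c.length : ℝ)) ∧
        ∃ (u v : H.verts) (p : H.coe.Walk u v), p.IsPath ∧
          (3 : ℝ) ^ (CruxCycles.averageDegree H / 2 -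
            f (CruxCycles.averageDegree H)) - 1 ≤ (p.length : ℝ)) := by
  refine ⟨CruxCycles.exponentError, CruxCycles.exponentError_isLittleO,
    fun m r hr H hd => CruxCycles.exists_isCycle_rpow_le_length hr ⊤ H hd, fun m H hH => ?_⟩
  have hcycle (hd : 2 ≤ CruxCycles.averageDegree H) :
      ∃ (v : H.verts) (c : H.coe.Walk v v), c.IsCycle ∧
        (3 : ℝ) ^ (CruxCycles.averageDegree H / 2 -
          CruxCycles.exponentError (CruxCycles.averageDegree H)) ≤ (c.length : ℝ) := by
    obtain ⟨v, c, hc, hlen⟩ :=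
      CruxCycles.exists_isCycle_rpow_le_length (by norm_num) (SimpleGraph.cycleGraph 3) H hd
    refine ⟨v, c, hc, ?_⟩
    norm_num at hlen
    exact hlen
  refine ⟨hcycle, ?_⟩
  by_cases hd : 2 ≤ CruxCycles.averageDegree H
  · obtain ⟨v, c, hc, hlen⟩ := hcycle hd
    refine ⟨_, _, c.tail, hc.isPath_tail, ?_⟩
    have h : c.tail.length + 1 = c.length := SimpleGraph.Walk.length_tail_add_one hc.not_nil
    have h' : (c.tail.length : ℝ) + 1 = c.length := by exact_mod_cast h
    linarith
  -- For `d < 2` the exponent is negative, so a single vertex is long enough.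
  · obtain ⟨v, hv⟩ := hH
    refine ⟨⟨v, hv⟩, ⟨v, hv⟩, .nil, .nil, ?_⟩
    have hs := Real.sqrt_nonneg (CruxCycles.averageDegree H)
    have := Real.rpow_le_one_of_one_le_of_nonpos (show (1 : ℝ) ≤ 3 by norm_num)
      (z := CruxCycles.averageDegree H / 2 -
        CruxCycles.exponentError (CruxCycles.averageDegree H))
      (by rw [CruxCycles.exponentError]; linarith)
    simpa using this
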